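/- **Conventions.** A *no-input, single-bit output two-party protocol* $\pi=(\mathsf A,\mathsf B)$ consists of two randomized parties with unlimited computational power. On the common security parameter $1^\kappa$ each party draws (discrete) private randomness (independently of the other party), the parties alternately exchange bit-string messages, for a number of messages that depends only on $\kappa$, and finally each party outputs one bit that depends on $\kappa$, its randomness and the messages. Let $X_\kappa,Y_\kappa\in\{0,1\}$ be the outputs of $\mathsf A$ and $\mathsf B$ and let $T_\kappa\in\{0,1\}^*$ be the transcript (the sequence of messages, encoded as a bit string) in a random execution. A *PPT algorithm* is a probabilistic Turing machine that halts, for all outcomes of its coins, within a number of steps bounded by a fixed polynomial in its input length. A *simulator* is a PPT algorithm that on every input $(1^\kappa,t)$, $\kappa\in\mathbb N$, $t\in\{0,1\}^*$, outputs two bits; $\mathsf{Sim}_\kappa(t)$ denotes its random output on $(1^\kappa,t)$. **Theorem 3.1 (Existence of simulators).** For every no-input, single-bit output two-party protocol $\pi$ (even an inefficient one), every real $\rho>0$ and every infinite set $\mathcal I\subseteq\mathbb N$, there exist a simulator $\mathsf{Sim}$ and an infinite set $\mathcal I'\subseteq\mathcal I$ such that the ensembles $(X_\kappa,Y_\kappa,T_\kappa)$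 and $(\mathsf{Sim}_\kappa(T_\kappa),T_\kappa)$ are $\rho$-indistinguishable in $\mathcal I'$. That is, for every PPT algorithm $\mathsf D$ and every sufficiently large $\kappa\in\mathcal I'$, $$\bigl|\Pr[\mathsf D(1^\kappa,X_\kappa,Y_\kappa,T_\kappa)=1]-\Pr[\mathsf D(1^\kappa,\mathsf{Sim}_\kappa(T_\kappa),T_\kappa)=1]\bigr|\le\rho .$$ -/

import Mathlib

namespace TwoParty

noncomputable section

/-! ### Probabilistic polynomial time -/

/-- A probabilistic Turing machine with finitely many stacks: Mathlib's multi-stack machine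
`Turing.FinTM2` with a second transition function. In every step a fair coin decides whether `m`
or `m'` is applied. The input is written on stack `k₀` and the output is read from stack `k₁`; both
stacks have the alphabet `{0, 1, #}`, where `#` is `none`. -/
structure ProbTM extends Turing.FinTM2 where
  /-- the transition function that is used when the coin comes up `1` -/
  m' : Λ → Turing.TM2.Stmt Γ Λ σ
  /-- the input alphabet is `{0, 1, #}` -/
  inputAlphabet : Γ k₀ ≃ Option Bool
  /-- the output alphabet is `{0, 1, #}` -/
  outputAlphabet : Γ k₁ ≃ Option Bool

namespace ProbTM

variable (M : ProbTM)

/-- The transition function selected by the coin `b`. -/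
def program (b : Bool) : M.Λ → Turing.TM2.Stmt M.Γ M.Λ M.σ :=
  if b then M.m' else M.m

/-- One step with coin `b`. A halted configuration does not change. -/
def stepWith (b : Bool) (c : M.Cfg) : M.Cfg :=
  (Turing.TM2.step (M.program b) c).getD c

/-- One step with a fair coin. -/
def stepDist (c : M.Cfg) : PMF M.Cfg :=
  (PMF.uniformOfFintype Bool).map fun b => M.stepWith b c

/-- The distribution of the configuration after `n` steps. The coins of distinct steps are
independent. -/
def runDist : ℕ → M.Cfg → PMF M.Cfg
  | 0, c => PMF.pure c
  | n + 1, c => (M.stepDist c).bind (runDist n)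

/-- The initial configuration: the input is on stack `k₀` (first symbol on top), and all other
stacks are empty. -/
def init (s : List (Option Bool)) : M.Cfg where
  l := some M.main
  var := M.initialState
  stk := Function.update (fun _ => []) M.k₀ (s.map M.inputAlphabet.symm)

/-- The output of a halted configuration (`none` if the machine has not halted yet). -/
def result (c : M.Cfg) : Option (List (Option Bool)) :=
  match c.l with
  | none => some ((c.stk M.k₁).map M.outputAlphabet)
  | some _ => none

end ProbTM

/-- The string `1^κ # s`, which represents the input `(1^κ, s)`. -/
def unaryPair (κ : ℕ) (s : List Bool) : List (Option Bool) :=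
  List.replicate κ (some true) ++ none :: s.map some

/-- `IsPPT ea eb f`: the randomized map that takes `(1^κ, a)` to a random element of `β` with
distribution `f κ a` is computed by a probabilistic machine in strictly polynomial time. Elements of
`α` and `β` are written as bit strings by `ea` and `eb`. On each input `(1^κ, a)` and for all outcomes
of the coins, the machine halts within the time that a fixed polynomial in the input length allows
(an outcome `none` of `result` would have positive probability otherwise). -/
def IsPPT {α β : Type} (ea : α → List Bool) (eb : β → List Bool) (f : ℕ → α → PMF β) : Prop :=
  ∃ (M : ProbTM) (p : Polynomial ℕ), ∀ (κ : ℕ) (a : α),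
    (M.runDist (p.eval (unaryPair κ (ea a)).length) (M.init (unaryPair κ (ea a)))).map M.result =
      (f κ a).map fun b => some ((eb b).map some)

/-! ### Computational indistinguishability -/

/-- The probability that the algorithm `D` outputs the string `1` on input `(1^κ, a)`, where `a` is
drawn from `μ`. -/
def acceptProb {α : Type} (D : ℕ → α → PMF (List Bool)) (κ : ℕ) (μ : PMF α) : ℝ :=
  ((μ.bind (D κ)) [true]).toReal

/-- The ensembles `X` and `Y` are `ρ`-indistinguishable in `I` for probabilistic polynomial-time
distinguishers, which receive `1^κ` and the sample, written as a bit string by `enc`. -/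
def IndistinguishableIn {α : Type} (enc : α → List Bool) (ρ : ℕ → ℝ) (I : Set ℕ)
    (X Y : ℕ → PMF α) : Prop :=
  ∀ D : ℕ → α → PMF (List Bool), IsPPT enc id D →
    ∃ κ₀ : ℕ, ∀ κ ∈ I, κ₀ ≤ κ → |acceptProb D κ (X κ) - acceptProb D κ (Y κ)| ≤ ρ κ

/-! ### Two-party protocols -/

/-- A party of a no-input, single-bit output protocol, with unlimited computational power. All its
randomness is a private string `r` with an arbitrary discrete distribution. -/
structure Party where
  /-- the distribution of the private random string, for security parameter `κ` -/
  coins : ℕ → PMF (List Bool)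
  /-- the next message, as a function of `κ`, the private random string and the messages so far -/
  message : ℕ → List Bool → List (List Bool) → List Bool
  /-- the output bit, as a function of `κ`, the private random string and all messages -/
  output : ℕ → List Bool → List (List Bool) → Bool

/-- A no-input, single-bit output two-party protocol. The parties send messages (bit strings, perhaps
empty) in turns, and party `A` starts. -/
structure Protocol where
  /-- the first party -/
  A : Party
  /-- the second party -/
  B : Party
  /-- the number of messages, for security parameter `κ` -/
  rounds : ℕ → ℕ

/-- A sequence of messages as one bit string: a bit `b` of a message is written as `1b`, and the end
of a message is written as `0`. -/
def encodeMessages (l : List (List Bool)) : List Bool :=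
  l.flatMap fun m => (m.flatMap fun b => [true, b]) ++ [false]

namespace Protocol

variable (π : Protocol)

/-- The first `n` messages of the execution in which the private random strings are `rA`, `rB`. -/
def messages (κ : ℕ) (rA rB : List Bool) : ℕ → List (List Bool)
  | 0 => []
  | n + 1 =>
    messages κ rA rB n ++
      [if Even n then π.A.message κ rA (messages κ rA rB n)
        else π.B.message κ rB (messages κ rA rB n)]

/-- The real distribution: the triple `(X_κ, Y_κ, T_κ)` of the output of `A`, the output of `B` and
the transcript in a random execution with security parameter `κ`. -/
def real (κ : ℕ) : PMF (Bool × Bool × List Bool) :=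
  (π.A.coins κ).bind fun rA => (π.B.coins κ).map fun rB =>
    (π.A.output κ rA (π.messages κ rA rB (π.rounds κ)),
      π.B.output κ rB (π.messages κ rA rB (π.rounds κ)),
      encodeMessages (π.messages κ rA rB (π.rounds κ)))

/-- The simulated distribution `(Sim(1^κ, T_κ), T_κ)`. -/
def simulated (Sim : ℕ → List Bool → PMF (Bool × Bool)) (κ : ℕ) : PMF (Bool × Bool × List Bool) :=
  (π.real κ).bind fun z => (Sim κ z.2.2).map fun b => (b.1, b.2, z.2.2)

end Protocol

/-- Two bits as a string. -/
def encodeBits (b : Bool × Bool) : List Bool := [b.1, b.2]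

/-- Two bits and a transcript as a string. -/
def encodeTriple (z : Bool × Bool × List Bool) : List Bool := z.1 :: z.2.1 :: z.2.2

/-- A simulator: a probabilistic polynomial-time algorithm that outputs two bits on each input
`(1^κ, t)`. -/
def IsSimulator (Sim : ℕ → List Bool → PMF (Bool × Bool)) : Prop :=
  IsPPT id encodeBits Sim

end

end TwoParty

/-! The proof is a potential argument. The potential of a simulator is the expected log-likelihood,
under the real execution, that it assigns to the true output pair given the transcript. It is never
positive, and the uniform simulator has potential `log (1/4)`.

Suppose that every simulator fails on every infinite subset of `I`. A failing simulator has a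
distinguisher `D` with advantage above `ρ` at infinitely many `κ`, and on an infinite subset the
advantage has a constant sign. So for some bit `s`, `D` answers `s` more often on simulated pairs
than on real ones. Replacing a pair on which `D` answers `s` by a fresh sample, with probability `ε
= 2⁻ⁿ`, multiplies the mass of each pair by `1 + ε * gap` (`toReal_resample`). The mean of the gap
under the real distribution is exactly the signed advantage (`acceptProb_simulated_sub_real`). As
`log (1 + x) ≥ x - 2x²` for `x ≥ -1/2`, the potential rises by at least `ερ - 2ε²`
(`potential_resample`), which is at least `ερ/2` for `ε ≤ ρ/4`. A number of rounds independent of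
`κ` makes the potential positive, a contradiction.

Each round calls the old simulator at most twice and `D` once, so it preserves strict polynomial
time (`IsSimulator.resample`). This is proved with an explicit stack machine that contains the
others as subroutines. -/

namespace TwoParty

open Turing

noncomputable section

/-! ### Runs of probabilistic machines -/

namespace ProbTM

variable {M : ProbTM}

theorem stepWith_of_halted {c : M.Cfg} (h : c.l = none) (b : Bool) : M.stepWith b c = c := by
  obtain ⟨l, v, S⟩ := c
  obtain rfl : l = none := h
  rfl

theorem stepDist_of_halted {c : M.Cfg} (h : c.l = none) : M.stepDist c = PMF.pure c := by
  have : (fun b => M.stepWith b c) = Function.const Bool c :=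
    funext fun b => stepWith_of_halted h b
  rw [stepDist, this, PMF.map_const]

theorem runDist_of_halted {c : M.Cfg} (h : c.l = none) (n : ℕ) : M.runDist n c = PMF.pure c := by
  induction n with
  | zero => rfl
  | succ n ih => rw [runDist, stepDist_of_halted h, PMF.pure_bind, ih]

/-- The recursion of `runDist` splits off the first step; extending a run that has already halted
needs the last step split off instead. -/
theorem runDist_succ_eq_bind_stepDist (n : ℕ) (c : M.Cfg) :
    M.runDist (n + 1) c = (M.runDist n c).bind M.stepDist := by
  induction n generalizing c with
  | zero => simp [runDist]
  | succ n ih =>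
    conv_lhs => rw [runDist, funext ih, ← PMF.bind_bind]
    rfl

theorem bind_congr_of_support {α β : Type*} (p : PMF α) {f g : α → PMF β}
    (h : ∀ a ∈ p.support, f a = g a) : p.bind f = p.bind g := by
  ext b
  simp only [PMF.bind_apply]
  refine tsum_congr fun a => ?_
  by_cases ha : a ∈ p.support
  · rw [h a ha]
  · rw [(p.apply_eq_zero_iff a).2 ha, zero_mul, zero_mul]

theorem result_eq_some_iff_halted {c : M.Cfg} : (∃ o, M.result c = some o) ↔ c.l = none := by
  rw [result]
  split <;> simp_all

/-- Started in `c`, the machine halts within `n` steps whatever the coins are, and its output has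
the distribution `ν`. -/
def Computes (M : ProbTM) (n : ℕ) (c : M.Cfg) (ν : PMF (List (Option Bool))) : Prop :=
  (M.runDist n c).map M.result = ν.map some

namespace Computes

theorem halted {n : ℕ} {c : M.Cfg} {ν : PMF (List (Option Bool))} (h : M.Computes n c ν) :
    ∀ c' ∈ (M.runDist n c).support, c'.l = none := by
  intro c' hc'
  have : M.result c' ∈ ((M.runDist n c).map M.result).support := by
    rw [PMF.support_map]
    exact ⟨c', hc', rfl⟩
  rw [Computes] at h
  rw [h, PMF.support_map] at this
  obtain ⟨o, -, ho⟩ := this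
  exact result_eq_some_iff_halted.1 ⟨o, ho.symm⟩

/-- Halted configurations are fixed by every step, so time bounds can be padded. Branches of
different lengths can thus share one bound. -/
theorem mono {n m : ℕ} {c : M.Cfg} {ν : PMF (List (Option Bool))} (h : M.Computes n c ν)
    (hnm : n ≤ m) : M.Computes m c ν := by
  induction m, hnm using Nat.le_induction with
  | base => exact h
  | succ m _ ih =>
    rw [Computes, runDist_succ_eq_bind_stepDist,
      bind_congr_of_support (g := PMF.pure) _ fun c' hc' => stepDist_of_halted (ih.halted c' hc'),
      PMF.bind_pure]
    exact ih

theorem of_halted {c : M.Cfg} (h : c.l = none) (n : ℕ) :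
    M.Computes n c (PMF.pure ((c.stk M.k₁).map M.outputAlphabet)) := by
  rw [Computes, runDist_of_halted h, PMF.pure_map, PMF.pure_map, result, h]

theorem of_coin {n : ℕ} {c : M.Cfg} {ν : Bool → PMF (List (Option Bool))}
    (h : ∀ b, M.Computes n (M.stepWith b c) (ν b)) :
    M.Computes (n + 1) c ((PMF.uniformOfFintype Bool).bind ν) := by
  rw [Computes, runDist, stepDist, PMF.bind_map, PMF.map_bind, PMF.map_bind]
  exact congrArg _ (funext h)

theorem of_step {n : ℕ} {c : M.Cfg} {ν : PMF (List (Option Bool))}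
    (h : ∀ b, M.Computes n (M.stepWith b c) ν) : M.Computes (n + 1) c ν := by
  simpa using of_coin h

/-- The distribution of what `g` reads off the final configuration, when `g` depends on the output
only. -/
theorem map_runDist {β : Type} {n : ℕ} {c : M.Cfg} {ν : PMF (List (Option Bool))}
    (h : M.Computes n c ν) (g : List (Option Bool) → β) :
    (M.runDist n c).map (fun c' => g ((c'.stk M.k₁).map M.outputAlphabet)) = ν.map g := by
  -- The default `[]` is never used, because every configuration in the support has halted.
  have key := congrArg (PMF.map fun o : Option (List (Option Bool)) => g (o.getD [])) h
  rw [PMF.map_comp, PMF.map_comp] at key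
  refine Eq.trans ?_ (key.trans ?_)
  · rw [← PMF.bind_pure_comp, ← PMF.bind_pure_comp]
    refine bind_congr_of_support _ fun c' hc' => ?_
    simp [result, h.halted c' hc']
  · rfl

end Computes

end ProbTM

/-! ### A machine that runs other machines as subroutines -/

namespace Composite

variable {ι A C F : Type} (N : ι → ProbTM)

/-- A stack of the composite machine: an auxiliary stack, or a stack of a subroutine. -/
abbrev Stack (A : Type) (N : ι → ProbTM) : Type := A ⊕ Σ i, (N i).K

/-- The alphabets of the composite machine. -/
abbrev Alphabet (A : Type) (N : ι → ProbTM) : Stack A N → Type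
  | .inl _ => Option Bool
  | .inr p => (N p.1).Γ p.2

/-- A label of the composite machine: a control label, or a label of a subroutine. -/
abbrev Label (C : Type) (N : ι → ProbTM) : Type := C ⊕ Σ i, (N i).Λ

/-- An internal state of the composite machine: flags and the internal states of all subroutines. -/
abbrev State (F : Type) (N : ι → ProbTM) : Type := F × ∀ i, (N i).σ

/-- The contents of all stacks: `aux` on the auxiliary stacks, `S i` on those of subroutine `i`. -/
def contents (aux : A → List (Option Bool)) (S : ∀ i k, List ((N i).Γ k)) :
    ∀ k : Stack A N, List (Alphabet A N k)
  | .inl a => aux a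
  | .inr p => S p.1 p.2

section Embedding

variable [DecidableEq ι]

/-- The program of the subroutine `i`, as a part of the composite machine: instead of halting, it
jumps to the control label `r`. -/
def embed (i : ι) (r : C) :
    TM2.Stmt (N i).Γ (N i).Λ (N i).σ → TM2.Stmt (Alphabet A N) (Label C N) (State F N)
  | .push k f q => .push (.inr ⟨i, k⟩) (fun v => f (v.2 i)) (embed i r q)
  | .peek k f q =>
    .peek (.inr ⟨i, k⟩) (fun v o => (v.1, Function.update v.2 i (f (v.2 i) o))) (embed i r q)
  | .pop k f q =>
    .pop (.inr ⟨i, k⟩) (fun v o => (v.1, Function.update v.2 i (f (v.2 i) o))) (embed i r q)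
  | .load f q => .load (fun v => (v.1, Function.update v.2 i (f (v.2 i)))) (embed i r q)
  | .branch f q q' => .branch (fun v => f (v.2 i)) (embed i r q) (embed i r q')
  | .goto f => .goto fun v => .inr ⟨i, f (v.2 i)⟩
  | .halt => .goto fun _ => .inl r

/-- The label of the composite machine when subroutine `i` is at label `l` and returns to `r`. -/
def subLabel (i : ι) (r : C) : Option (N i).Λ → Label C N
  | none => .inl r
  | some l => .inr ⟨i, l⟩

/-- The configuration of the composite machine when the subroutine `i` is in the configuration
`c`, and the internal states and the stacks of the other subroutines are given by `vs` and `S`. -/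
def running (i : ι) (r : C) (f : F) (aux : A → List (Option Bool)) (vs : ∀ i, (N i).σ)
    (S : ∀ i k, List ((N i).Γ k)) (c : TM2.Cfg (N i).Γ (N i).Λ (N i).σ) :
    TM2.Cfg (Alphabet A N) (Label C N) (State F N) :=
  ⟨some (subLabel N i r c.l), (f, Function.update vs i c.var),
    contents N aux (Function.update S i c.stk)⟩

variable [DecidableEq A]

theorem update_contents_inl (aux : A → List (Option Bool)) (S : ∀ i k, List ((N i).Γ k)) (a : A)
    (w : List (Option Bool)) :
    Function.update (contents N aux S) (.inl a) w = contents N (Function.update aux a w) S := by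
  funext k
  rcases k with b | p
  · by_cases h : b = a
    · subst h; simp [contents]
    · rw [Function.update_of_ne (by simpa using h)]
      simp [contents, h]
  · rw [Function.update_of_ne (by simp)]
    simp [contents]

theorem update_contents_inr (aux : A → List (Option Bool)) (S : ∀ i k, List ((N i).Γ k)) (i : ι)
    (k : (N i).K) (w : List ((N i).Γ k)) :
    Function.update (contents N aux S) (.inr ⟨i, k⟩) w =
      contents N aux (Function.update S i (Function.update (S i) k w)) := by
  funext k'
  rcases k' with b | ⟨j, k'⟩
  · rw [Function.update_of_ne (by simp)]
    simp [contents]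
  · by_cases h : j = i
    · subst h
      by_cases hk : k' = k
      · subst hk; simp [contents]
      · rw [Function.update_of_ne (by simpa using hk)]
        simp [contents, hk]
    · rw [Function.update_of_ne (by simp [h])]
      simp [contents, h]

/-- Every statement acts only on the component of subroutine `i`. The one altered statement is
`halt`, and `subLabel` sends a halted subroutine to the return label accordingly. -/
theorem stepAux_embed (i : ι) (r : C) (f : F) (aux : A → List (Option Bool)) (vs : ∀ i, (N i).σ)
    (S : ∀ i k, List ((N i).Γ k)) (q : TM2.Stmt (N i).Γ (N i).Λ (N i).σ) (v : (N i).σ)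
    (T : ∀ k, List ((N i).Γ k)) :
    TM2.stepAux (embed N i r q) (f, Function.update vs i v)
        (contents N aux (Function.update S i T)) =
      running N i r f aux vs S (TM2.stepAux q v T) := by
  have hT : ∀ (T : ∀ k, List ((N i).Γ k)) (k : (N i).K),
      contents N aux (Function.update S i T) (.inr ⟨i, k⟩) = T k := by
    intro T k
    simp [contents]
  induction q generalizing v T with
  | push k g q ih =>
    simp only [embed, TM2.stepAux, update_contents_inr, Function.update_idem, hT,
      Function.update_self, ih]
  | peek k g q ih =>
    simp only [embed, TM2.stepAux, Function.update_idem, hT, Function.update_self, ih]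
  | pop k g q ih =>
    simp only [embed, TM2.stepAux, update_contents_inr, Function.update_idem, hT,
      Function.update_self, ih]
  | load g q ih =>
    simp only [embed, TM2.stepAux, Function.update_idem, Function.update_self, ih]
  | branch g q q' ih ih' =>
    simp only [embed, TM2.stepAux, Function.update_self, ih, ih']
    cases g v <;> rfl
  | goto g => simp [embed, TM2.stepAux, running, subLabel]
  | halt => simp [embed, TM2.stepAux, running, subLabel]

end Embedding

variable [DecidableEq ι] [Fintype ι] [DecidableEq A] [Fintype A] [Fintype C] [Fintype F]

/-- The machine with the control program `ctl` and the subroutines `N i`. The subroutine `i` jumps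
to the control label `ret i` at its end. Input and output are on the auxiliary stack `a`. -/
def machine (a : A) (start : C) (flags : F) (ret : ι → C)
    (ctl : Bool → C → TM2.Stmt (Alphabet A N) (Label C N) (State F N)) : ProbTM where
  K := Stack A N
  kDecidableEq := inferInstance
  kFin := by
    haveI := fun i => (N i).kFin
    infer_instance
  k₀ := .inl a
  k₁ := .inl a
  Γ := Alphabet A N
  Λ := Label C N
  main := .inl start
  ΛFin := by
    haveI := fun i => (N i).ΛFin
    infer_instance
  σ := State F N
  initialState := (flags, fun i => (N i).initialState)
  σFin := by
    haveI := fun i => (N i).σFin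
    infer_instance
  Γk₀Fin := inferInstanceAs (Fintype (Option Bool))
  m := Sum.elim (ctl false) fun p => embed N p.1 (ret p.1) ((N p.1).m p.2)
  m' := Sum.elim (ctl true) fun p => embed N p.1 (ret p.1) ((N p.1).m' p.2)
  inputAlphabet := Equiv.refl _
  outputAlphabet := Equiv.refl _

variable {N} {a : A} {start : C} {flags : F} {ret : ι → C}
  {ctl : Bool → C → TM2.Stmt (Alphabet A N) (Label C N) (State F N)}

theorem stepWith_control (b : Bool) (l : C) (v : State F N)
    (S : ∀ k : Stack A N, List (Alphabet A N k)) :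
    (machine N a start flags ret ctl).stepWith b (⟨some (.inl l), v, S⟩ : TM2.Cfg _ _ _) =
      TM2.stepAux (ctl b l) v S := by
  cases b <;> rfl

/-- The hypothesis `hc` is essential: once the subroutine has halted, the composite machine
continues with the control program while the subroutine stands still. -/
theorem stepWith_running (b : Bool) (i : ι) (f : F) (aux : A → List (Option Bool))
    (vs : ∀ i, (N i).σ) (S : ∀ i k, List ((N i).Γ k)) (c : (N i).Cfg) (hc : c.l ≠ none) :
    (machine N a start flags ret ctl).stepWith b (running N i (ret i) f aux vs S c) =
      running N i (ret i) f aux vs S ((N i).stepWith b c) := by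
  obtain ⟨l, v, T⟩ := c
  obtain ⟨l, rfl⟩ := Option.ne_none_iff_exists'.1 hc
  cases b <;> exact stepAux_embed N i (ret i) f aux vs S _ v T

/-- A run of a subroutine, followed by a computation from the control label to which it jumps. -/
theorem computes_running (i : ι) (f : F) (aux : A → List (Option Bool))
    (vs : ∀ i, (N i).σ) (S : ∀ i k, List ((N i).Γ k)) {n m : ℕ} {c : (N i).Cfg}
    (ν : (N i).Cfg → PMF (List (Option Bool)))
    (hν : ∀ c' ∈ ((N i).runDist n c).support, (machine N a start flags ret ctl).Computes m
      (running N i (ret i) f aux vs S c') (ν c')) :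
    (machine N a start flags ret ctl).Computes (n + m) (running N i (ret i) f aux vs S c)
      (((N i).runDist n c).bind ν) := by
  induction n generalizing c with
  | zero => simpa [ProbTM.runDist] using hν
  | succ n ih =>
    -- The subroutine may halt before its time bound, differently for different coins. The composite
    -- then moves on at once, and the unused steps are absorbed by `mono`.
    by_cases hc : c.l = none
    · rw [ProbTM.runDist_of_halted hc, PMF.pure_bind]
      exact (hν c (by rw [ProbTM.runDist_of_halted hc]; simp)).mono (by omega)
    · rw [ProbTM.runDist, ProbTM.stepDist, PMF.bind_map, PMF.bind_bind, add_right_comm]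
      refine ProbTM.Computes.of_coin fun b => ?_
      rw [stepWith_running _ _ _ _ _ _ _ hc]
      refine ih fun c' hc' => hν c' ?_
      rw [ProbTM.runDist, PMF.mem_support_bind_iff]
      refine ⟨_, ?_, hc'⟩
      rw [ProbTM.stepDist, PMF.support_map]
      exact ⟨b, by simp, rfl⟩

/-- A run of a subroutine whose output is known, followed by a computation that depends only on
what `g` reads off this output. -/
theorem computes_running_of_computes {β : Type} (i : ι) (f : F) (aux : A → List (Option Bool))
    (vs : ∀ i, (N i).σ) (S : ∀ i k, List ((N i).Γ k)) {n m : ℕ} {c : (N i).Cfg}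
    {μ : PMF (List (Option Bool))} (hc : (N i).Computes n c μ) (g : List (Option Bool) → β)
    (ν : β → PMF (List (Option Bool)))
    (hν : ∀ c' : (N i).Cfg, (machine N a start flags ret ctl).Computes m
      ⟨some (.inl (ret i)), (f, Function.update vs i c'.var),
        contents N aux (Function.update S i c'.stk)⟩
      (ν (g ((c'.stk (N i).k₁).map (N i).outputAlphabet)))) :
    (machine N a start flags ret ctl).Computes (n + m) (running N i (ret i) f aux vs S c)
      ((μ.map g).bind ν) := by
  rw [← hc.map_runDist, PMF.bind_map]
  refine computes_running i f aux vs S _ fun c' hc' => ?_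
  have h := hc.halted c' hc'
  obtain ⟨l, v, T⟩ := c'
  obtain rfl : l = none := h
  exact hν _

end Composite

/-! ### Algorithms as machines, and the resampling step -/

theorem ProbTM.update_init_stk (M : ProbTM) (x : Option Bool) (w : List (Option Bool)) :
    Function.update (M.init w).stk M.k₀ (M.inputAlphabet.symm x :: (M.init w).stk M.k₀) =
      (M.init (x :: w)).stk := by
  simp [ProbTM.init]

/-- The algorithm that computes `f` runs correctly on every input. -/
theorem IsPPT.exists_computes {α β : Type} {ea : α → List Bool} {eb : β → List Bool}
    {f : ℕ → α → PMF β} (h : IsPPT ea eb f) :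
    ∃ (M : ProbTM) (p : Polynomial ℕ), ∀ (κ : ℕ) (a : α),
      M.Computes (p.eval (unaryPair κ (ea a)).length) (M.init (unaryPair κ (ea a)))
        ((f κ a).map fun b => (eb b).map some) := by
  obtain ⟨M, p, h⟩ := h
  refine ⟨M, p, fun κ a => ?_⟩
  rw [ProbTM.Computes, h, PMF.map_comp]
  rfl

theorem isPPT_of_computes {α β : Type} {ea : α → List Bool} {eb : β → List Bool}
    {f : ℕ → α → PMF β} (M : ProbTM) (p : Polynomial ℕ)
    (h : ∀ (κ : ℕ) (a : α),
      M.Computes (p.eval (unaryPair κ (ea a)).length) (M.init (unaryPair κ (ea a)))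
        ((f κ a).map fun b => (eb b).map some)) : IsPPT ea eb f := by
  refine ⟨M, p, fun κ a => ?_⟩
  rw [h κ a, PMF.map_comp]
  rfl

/-- A coin that shows `true` with probability `2⁻ⁿ`. -/
def dyadicCoin : ℕ → PMF Bool
  | 0 => PMF.pure true
  | n + 1 => (PMF.uniformOfFintype Bool).bind fun b => if b then PMF.pure false else dyadicCoin n

/-- The answer of the distinguisher: whether it outputs the string `1`. -/
def accepts (D : ℕ → Bool × Bool × List Bool → PMF (List Bool)) (κ : ℕ)
    (z : Bool × Bool × List Bool) : PMF Bool :=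
  (D κ z).map fun o => decide (o = [true])

/-- The simulator that samples two bits by `Sim`, and if the distinguisher `D` answers `s` on them,
replaces them by a fresh sample with probability `2⁻ⁿ`. -/
def resample (Sim : ℕ → List Bool → PMF (Bool × Bool))
    (D : ℕ → Bool × Bool × List Bool → PMF (List Bool)) (s : Bool) (n : ℕ) (κ : ℕ)
    (t : List Bool) : PMF (Bool × Bool) :=
  (Sim κ t).bind fun z => (accepts D κ (z.1, z.2, t)).bind fun b =>
    (dyadicCoin n).bind fun c => if c && (b == s) then Sim κ t else PMF.pure z

/-! ### The polynomial-time machine of the resampling step -/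

namespace Resample

/-- The subroutines: two copies of the simulator, and the distinguisher. -/
inductive Sub
  | first
  | second
  | judge
  deriving DecidableEq

instance : Fintype Sub := ⟨{.first, .second, .judge}, fun i => by cases i <;> simp⟩

/-- The function with the given values. -/
def triple {X : Sub → Type} (x : X .first) (y : X .second) (z : X .judge) : ∀ i, X i
  | .first => x
  | .second => y
  | .judge => z

section triple

variable {X : Sub → Type} (x x' : X .first) (y y' : X .second) (z z' : X .judge)

@[simp] theorem triple_first : triple x y z .first = x := rfl
@[simp] theorem triple_second : triple x y z .second = y := rfl
@[simp] theorem triple_judge : triple x y z .judge = z := rfl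

@[simp] theorem update_triple_first :
    Function.update (triple x y z) .first x' = triple x' y z := by
  funext i; cases i <;> simp

@[simp] theorem update_triple_second :
    Function.update (triple x y z) .second y' = triple x y' z := by
  funext i; cases i <;> simp

@[simp] theorem update_triple_judge :
    Function.update (triple x y z) .judge z' = triple x y z' := by
  funext i; cases i <;> simp

end triple

/-- The function on `Bool` with the given values. -/
def pair {X : Type} (x y : X) : Bool → X
  | false => x
  | true => y

section pair

variable {X : Type} (x x' y y' : X)

@[simp] theorem pair_false : pair x y false = x := rfl
@[simp] theorem pair_true : pair x y true = y := rfl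

@[simp] theorem update_pair_false : Function.update (pair x y) false x' = pair x' y := by
  funext i; cases i <;> simp

@[simp] theorem update_pair_true : Function.update (pair x y) true y' = pair x y' := by
  funext i; cases i <;> simp

end pair

/-- The control labels. -/
inductive Ctl (n : ℕ)
  | reverse
  | spread
  | unary
  | load
  | coin (j : Fin (n + 1))
  | write
  | ret (i : Sub)
  deriving Fintype

/-- The flags: the symbol that was read last, the current two bits, and whether the answer of the
distinguisher calls for a fresh sample. -/
abbrev Flags : Type := Option (Option Bool) × (Bool × Bool) × Bool

variable (MS MD : ProbTM) (s : Bool) (n : ℕ)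

/-- The machines of the subroutines. -/
abbrev subs : Sub → ProbTM
  | .first => MS
  | .second => MS
  | .judge => MD

/-- The two bits at the beginning of an output. -/
def readBits (l : List (Option Bool)) : Bool × Bool :=
  (l.head?.join.getD false, l.tail.head?.join.getD false)

/-- Statements of the control program. -/
abbrev Program : Type :=
  TM2.Stmt (Composite.Alphabet Bool (subs MS MD)) (Composite.Label (Ctl n) (subs MS MD))
    (Composite.State Flags (subs MS MD))

variable {MS MD n} in
/-- Pop a symbol from an auxiliary stack. -/
def popAux (a : Bool) (q : Program MS MD n) : Program MS MD n :=
  .pop (.inl a) (fun v o => ((o, v.1.2), v.2)) q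

variable {MS MD n} in
/-- Push the current symbol on an auxiliary stack. -/
def pushAux (a : Bool) (q : Program MS MD n) : Program MS MD n :=
  .push (.inl a) (fun v => v.1.1.getD none) q

variable {MS MD n} in
/-- Push a symbol on the input stack of a subroutine. -/
def pushSub (i : Sub) (x : Flags → Option Bool) (q : Program MS MD n) : Program MS MD n :=
  .push (.inr ⟨i, (subs MS MD i).k₀⟩) (fun v => (subs MS MD i).inputAlphabet.symm (x v.1)) q

variable {MS MD n} in
/-- Pop a symbol from the output stack of a subroutine. -/
def popSub (i : Sub) (x : Flags → Option (Option Bool) → Flags) (q : Program MS MD n) :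
    Program MS MD n :=
  .pop (.inr ⟨i, (subs MS MD i).k₁⟩)
    (fun v o => (x v.1 (o.map (subs MS MD i).outputAlphabet), v.2)) q

variable {MS MD n} in
/-- Read the two bits that are the output of a subroutine. -/
def popBits (i : Sub) (q : Program MS MD n) : Program MS MD n :=
  popSub i (fun f o => (f.1, (o.join.getD false, f.2.1.2), f.2.2)) <|
    popSub i (fun f o => (f.1, (f.2.1.1, o.join.getD false), f.2.2)) q

/-- The control program. -/
def control (c : Bool) : Ctl n → Program MS MD n
  | .reverse => popAux false <| .branch (fun v => v.1.1.isSome)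
      (pushAux true <| .goto fun _ => .inl .reverse)
      (.goto fun _ => .inl .spread)
  | .spread => popAux true <| .branch (fun v => v.1.1.join.isSome)
      (pushSub .first (fun f => f.1.getD none) <| pushSub .second (fun f => f.1.getD none) <|
        pushSub .judge (fun f => f.1.getD none) <| .goto fun _ => .inl .spread)
      (pushSub .first (fun _ => none) <| pushSub .second (fun _ => none) <|
        .goto fun _ => .inl .unary)
  | .unary => popAux true <| .branch (fun v => v.1.1.isSome)
      (pushSub .first (fun f => f.1.getD none) <| pushSub .second (fun f => f.1.getD none) <|
        pushAux false <| .goto fun _ => .inl .unary)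
      (.goto fun _ => .inr ⟨.first, MS.main⟩)
  | .ret .first => popBits .first <| pushSub .judge (fun f => some f.2.1.2) <|
      pushSub .judge (fun f => some f.2.1.1) <| pushSub .judge (fun _ => none) <|
        .goto fun _ => .inl .load
  | .load => popAux false <| .branch (fun v => v.1.1.isSome)
      (pushSub .judge (fun f => f.1.getD none) <| .goto fun _ => .inl .load)
      (.goto fun _ => .inr ⟨.judge, MD.main⟩)
  | .ret .judge => popSub .judge (fun f o => (o, f.2)) <|
      popSub .judge (fun f o => (f.1, f.2.1, decide (f.1 = some (some true) ∧ o = none) == s)) <|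
        .goto fun _ => .inl (.coin (Fin.last n))
  | .coin j => Fin.cases
      (.branch (fun v => v.1.2.2) (.goto fun _ => .inr ⟨.second, MS.main⟩)
        (.goto fun _ => .inl .write))
      (fun j => .goto fun _ => .inl (if c then .write else .coin j.castSucc)) j
  | .ret .second => popBits .second <| .goto fun _ => .inl .write
  | .write => .push (.inl false) (fun v => some v.1.2.1.2) <|
      .push (.inl false) (fun v => some v.1.2.1.1) .halt

/-- The machine of the simulator `resample`. -/
def machine : ProbTM :=
  Composite.machine (subs MS MD) false (.reverse : Ctl n) ((none, (false, false), false) : Flags)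
    .ret (control MS MD s n)

/-- A configuration of `machine`. -/
def cfg (l : Composite.Label (Ctl n) (subs MS MD)) (f : Flags) (x y : List (Option Bool))
    (v₁ v₂ : MS.σ) (v₃ : MD.σ) (S₁ S₂ : ∀ k, List (MS.Γ k)) (S₃ : ∀ k, List (MD.Γ k)) :
    (machine MS MD s n).Cfg :=
  (⟨some l, (f, triple (X := fun i => (subs MS MD i).σ) v₁ v₂ v₃),
    Composite.contents _ (pair x y)
      (triple (X := fun i => ∀ k, List ((subs MS MD i).Γ k)) S₁ S₂ S₃)⟩ : TM2.Cfg _ _ _)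

variable {MS MD s n}
variable {f : Flags} {x y w u : List (Option Bool)} {v₁ v₂ : MS.σ} {v₃ : MD.σ}
  {S₁ S₂ : ∀ k, List (MS.Γ k)} {S₃ : ∀ k, List (MD.Γ k)} {m : ℕ}
  {ν : PMF (List (Option Bool))}

theorem stepWith_cfg (b : Bool) (l : Ctl n) :
    (machine MS MD s n).stepWith b (cfg MS MD s n (.inl l) f x y v₁ v₂ v₃ S₁ S₂ S₃) =
      TM2.stepAux (control MS MD s n b l) (f, triple (X := fun i => (subs MS MD i).σ) v₁ v₂ v₃)
        (Composite.contents _ (pair x y)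
          (triple (X := fun i => ∀ k, List ((subs MS MD i).Γ k)) S₁ S₂ S₃)) :=
  Composite.stepWith_control _ _ _ _

theorem contents_inl (a : Bool) (aux : Bool → List (Option Bool))
    (S : ∀ i k, List ((subs MS MD i).Γ k)) :
    Composite.contents (subs MS MD) aux S (.inl a) = aux a := rfl

theorem contents_inr (i : Sub) (k : (subs MS MD i).K) (aux : Bool → List (Option Bool))
    (S : ∀ i k, List ((subs MS MD i).Γ k)) :
    Composite.contents (subs MS MD) aux S (.inr ⟨i, k⟩) = S i k := rfl

/-- While its input is being loaded, a subroutine always has the initial stacks of some shorter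
word. This invariant, shared by the two analogues below, is what the loading loops maintain. -/
theorem stepAux_pushSub_first {vs : ∀ i, (subs MS MD i).σ} {aux : Bool → List (Option Bool)}
    (g : Flags → Option Bool) (q : Program MS MD n) :
    TM2.stepAux (pushSub .first g q) (f, vs) (Composite.contents _ aux
        (triple (X := fun i => ∀ k, List ((subs MS MD i).Γ k)) (MS.init w).stk S₂ S₃)) =
      TM2.stepAux q (f, vs) (Composite.contents _ aux
        (triple (X := fun i => ∀ k, List ((subs MS MD i).Γ k)) (MS.init (g f :: w)).stk S₂ S₃)) := by
  simp only [pushSub, TM2.stepAux, Composite.update_contents_inr, update_triple_first, contents_inr,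
    triple_first]
  exact congrArg (fun S => TM2.stepAux q (f, vs) (Composite.contents _ aux
    (triple (X := fun i => ∀ k, List ((subs MS MD i).Γ k)) S S₂ S₃))) (MS.update_init_stk _ _)

theorem stepAux_pushSub_second {vs : ∀ i, (subs MS MD i).σ} {aux : Bool → List (Option Bool)}
    (g : Flags → Option Bool) (q : Program MS MD n) :
    TM2.stepAux (pushSub .second g q) (f, vs) (Composite.contents _ aux
        (triple (X := fun i => ∀ k, List ((subs MS MD i).Γ k)) S₁ (MS.init w).stk S₃)) =
      TM2.stepAux q (f, vs) (Composite.contents _ aux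
        (triple (X := fun i => ∀ k, List ((subs MS MD i).Γ k)) S₁ (MS.init (g f :: w)).stk S₃)) := by
  simp only [pushSub, TM2.stepAux, Composite.update_contents_inr, update_triple_second,
    contents_inr, triple_second]
  exact congrArg (fun S => TM2.stepAux q (f, vs) (Composite.contents _ aux
    (triple (X := fun i => ∀ k, List ((subs MS MD i).Γ k)) S₁ S S₃))) (MS.update_init_stk _ _)

theorem stepAux_pushSub_judge {vs : ∀ i, (subs MS MD i).σ} {aux : Bool → List (Option Bool)}
    (g : Flags → Option Bool) (q : Program MS MD n) :
    TM2.stepAux (pushSub .judge g q) (f, vs) (Composite.contents _ aux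
        (triple (X := fun i => ∀ k, List ((subs MS MD i).Γ k)) S₁ S₂ (MD.init w).stk)) =
      TM2.stepAux q (f, vs) (Composite.contents _ aux
        (triple (X := fun i => ∀ k, List ((subs MS MD i).Γ k)) S₁ S₂ (MD.init (g f :: w)).stk)) := by
  simp only [pushSub, TM2.stepAux, Composite.update_contents_inr, update_triple_judge, contents_inr,
    triple_judge]
  exact congrArg (fun S => TM2.stepAux q (f, vs) (Composite.contents _ aux
    (triple (X := fun i => ∀ k, List ((subs MS MD i).Γ k)) S₁ S₂ S))) (MD.update_init_stk _ _)

/-- The output stack is also the input stack, so it must have been emptied before. The second bit is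
pushed first, to end up below the first one. -/
theorem computes_write : (machine MS MD s n).Computes 1
    (cfg MS MD s n (.inl .write) f [] y v₁ v₂ v₃ S₁ S₂ S₃)
    (PMF.pure [some f.2.1.1, some f.2.1.2]) := by
  refine ProbTM.Computes.of_step fun b => ?_
  rw [stepWith_cfg]
  simp only [control, TM2.stepAux, contents_inl, Composite.update_contents_inl, Function.update_self,
    pair_false, update_pair_false]
  exact ProbTM.Computes.of_halted rfl 0

/-- Subroutine inputs must be pushed last symbol first, so the input is turned over once before it
is distributed. -/
theorem computes_reverse (h : ∀ r, (machine MS MD s n).Computes m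
      (cfg MS MD s n (.inl .spread) (r, f.2) [] (x.reverse ++ w) v₁ v₂ v₃ S₁ S₂ S₃) ν) :
    (machine MS MD s n).Computes (m + 1 + x.length)
      (cfg MS MD s n (.inl .reverse) f x w v₁ v₂ v₃ S₁ S₂ S₃) ν := by
  induction x generalizing w f with
  | nil =>
    refine ProbTM.Computes.of_step fun b => ?_
    rw [stepWith_cfg]
    simp only [control, popAux, TM2.stepAux, contents_inl, Composite.update_contents_inl,
      pair_false, update_pair_false]
    exact h _
  | cons a x ih =>
    refine ProbTM.Computes.of_step fun b => ?_
    rw [stepWith_cfg]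
    simp only [control, popAux, pushAux, TM2.stepAux, contents_inl, Composite.update_contents_inl,
      pair_false, update_pair_false, pair_true, update_pair_true, List.head?_cons,
      Option.isSome_some, cond_true, Option.getD_some, List.tail_cons]
    exact ih (f := (some a, f.2)) (w := a :: w) fun r => by simpa using h r

/-- The distinguisher does not receive the separator yet: in its input the two simulated bits stand
between `#` and `t`, and they are not known at this stage. -/
theorem computes_spread {t : List Bool} {u₁ u₂ u₃ : List (Option Bool)}
    (h : ∀ r, (machine MS MD s n).Computes m
      (cfg MS MD s n (.inl .unary) (r, f.2) x y v₁ v₂ v₃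
        (MS.init (none :: (t.reverse.map some ++ u₁))).stk
        (MS.init (none :: (t.reverse.map some ++ u₂))).stk
        (MD.init (t.reverse.map some ++ u₃)).stk) ν) :
    (machine MS MD s n).Computes (m + 1 + t.length)
      (cfg MS MD s n (.inl .spread) f x (t.map some ++ none :: y) v₁ v₂ v₃
        (MS.init u₁).stk (MS.init u₂).stk (MD.init u₃).stk) ν := by
  induction t generalizing u₁ u₂ u₃ f with
  | nil =>
    refine ProbTM.Computes.of_step fun b => ?_
    rw [stepWith_cfg]
    simp only [control, popAux, TM2.stepAux, contents_inl, Composite.update_contents_inl,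
      stepAux_pushSub_first, stepAux_pushSub_second, stepAux_pushSub_judge,
      pair_true, update_pair_true, List.map_nil, List.nil_append, List.head?_cons,
      Option.join_some, Option.isSome_none, cond_false, List.tail_cons]
    exact h _
  | cons a t ih =>
    refine ProbTM.Computes.of_step fun b => ?_
    rw [stepWith_cfg]
    simp only [control, popAux, TM2.stepAux, contents_inl, Composite.update_contents_inl,
      stepAux_pushSub_first, stepAux_pushSub_second, stepAux_pushSub_judge,
      pair_true, update_pair_true, List.map_cons, List.cons_append, List.head?_cons,
      Option.join_some, Option.isSome_some, cond_true, Option.getD_some, List.tail_cons]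
    exact ih (f := (some (some a), f.2)) fun r => by simpa using h r

theorem replicate_append_cons {α : Type} (k : ℕ) (a : α) (l : List α) :
    List.replicate k a ++ a :: l = List.replicate (k + 1) a ++ l := by
  simp [List.replicate_succ']

/-- The unary part is saved on the auxiliary stack `false`, because the distinguisher can receive it
only after the simulated bits. The second copy of the simulator is loaded now, so that a fresh
sample needs no further copying. -/
theorem computes_unary {k : ℕ} {u₁ u₂ : List (Option Bool)}
    (h : ∀ r, (machine MS MD s n).Computes m
      (cfg MS MD s n (.inr ⟨.first, MS.main⟩) (r, f.2) (List.replicate k (some true) ++ x) []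
        v₁ v₂ v₃ (MS.init (List.replicate k (some true) ++ u₁)).stk
        (MS.init (List.replicate k (some true) ++ u₂)).stk S₃) ν) :
    (machine MS MD s n).Computes (m + 1 + k)
      (cfg MS MD s n (.inl .unary) f x (List.replicate k (some true)) v₁ v₂ v₃
        (MS.init u₁).stk (MS.init u₂).stk S₃) ν := by
  induction k generalizing u₁ u₂ x f with
  | zero =>
    refine ProbTM.Computes.of_step fun b => ?_
    rw [stepWith_cfg]
    simp only [control, popAux, TM2.stepAux, contents_inl, Composite.update_contents_inl,
      pair_true, update_pair_true]
    exact h _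
  | succ k ih =>
    refine ProbTM.Computes.of_step fun b => ?_
    rw [stepWith_cfg]
    simp only [control, popAux, pushAux, TM2.stepAux, contents_inl, Composite.update_contents_inl,
      stepAux_pushSub_first, stepAux_pushSub_second, pair_false,
      update_pair_false, pair_true, update_pair_true, List.replicate_succ, List.head?_cons,
      Option.isSome_some, cond_true, Option.getD_some, List.tail_cons]
    refine ih (f := (some (some true), f.2)) fun r => ?_
    simpa only [replicate_append_cons] using h r

theorem computes_load {k : ℕ} {u : List (Option Bool)}
    (h : ∀ r, (machine MS MD s n).Computes m
      (cfg MS MD s n (.inr ⟨.judge, MD.main⟩) (r, f.2) [] y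
        v₁ v₂ v₃ S₁ S₂ (MD.init (List.replicate k (some true) ++ u)).stk) ν) :
    (machine MS MD s n).Computes (m + 1 + k)
      (cfg MS MD s n (.inl .load) f (List.replicate k (some true)) y v₁ v₂ v₃ S₁ S₂
        (MD.init u).stk) ν := by
  induction k generalizing u f with
  | zero =>
    refine ProbTM.Computes.of_step fun b => ?_
    rw [stepWith_cfg]
    simp only [control, popAux, TM2.stepAux, contents_inl, Composite.update_contents_inl,
      pair_false, update_pair_false]
    exact h _
  | succ k ih =>
    refine ProbTM.Computes.of_step fun b => ?_
    rw [stepWith_cfg]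
    simp only [control, popAux, TM2.stepAux, contents_inl, Composite.update_contents_inl,
      stepAux_pushSub_judge, pair_false,
      update_pair_false, List.replicate_succ, List.head?_cons,
      Option.isSome_some, cond_true, Option.getD_some, List.tail_cons]
    refine ih (f := (some (some true), f.2)) fun r => ?_
    simpa only [replicate_append_cons] using h r

theorem computes_ret_first {z : Bool × Bool} {u : List (Option Bool)}
    (hz : readBits ((S₁ MS.k₁).map MS.outputAlphabet) = z)
    (h : ∀ S₁, (machine MS MD s n).Computes m
      (cfg MS MD s n (.inl .load) (f.1, z, f.2.2) x y v₁ v₂ v₃ S₁ S₂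
        (MD.init (none :: some z.1 :: some z.2 :: u)).stk) ν) :
    (machine MS MD s n).Computes (m + 1)
      (cfg MS MD s n (.inl (.ret .first)) f x y v₁ v₂ v₃ S₁ S₂ (MD.init u).stk) ν := by
  refine ProbTM.Computes.of_step fun b => ?_
  rw [stepWith_cfg]
  simp only [control, popBits, popSub, TM2.stepAux, contents_inr,
    Composite.update_contents_inr, triple_first, update_triple_first,
    stepAux_pushSub_judge, Function.update_self]
  rw [readBits, ← List.map_tail, List.head?_map, List.head?_map] at hz
  subst hz
  exact h _

theorem computes_ret_second {z : Bool × Bool}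
    (hz : readBits ((S₂ MS.k₁).map MS.outputAlphabet) = z) :
    (machine MS MD s n).Computes 2
      (cfg MS MD s n (.inl (.ret .second)) f [] y v₁ v₂ v₃ S₁ S₂ S₃)
      (PMF.pure [some z.1, some z.2]) := by
  refine ProbTM.Computes.of_step fun b => ?_
  rw [stepWith_cfg]
  simp only [control, popBits, popSub, TM2.stepAux, contents_inr,
    Composite.update_contents_inr, triple_second, update_triple_second, Function.update_self]
  rw [readBits, ← List.map_tail, List.head?_map, List.head?_map] at hz
  subst hz
  exact computes_write

/-- Whether an output is the string `1`. -/
def readAnswer (l : List (Option Bool)) : Bool :=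
  decide (l.head? = some (some true) ∧ l.tail.head? = none)

theorem computes_ret_judge {a : Bool}
    (ha : readAnswer ((S₃ MD.k₁).map MD.outputAlphabet) = a)
    (h : ∀ r S₃, (machine MS MD s n).Computes m
      (cfg MS MD s n (.inl (.coin (Fin.last n))) (r, f.2.1, a == s) x y v₁ v₂ v₃ S₁ S₂ S₃) ν) :
    (machine MS MD s n).Computes (m + 1)
      (cfg MS MD s n (.inl (.ret .judge)) f x y v₁ v₂ v₃ S₁ S₂ S₃) ν := by
  refine ProbTM.Computes.of_step fun b => ?_
  rw [stepWith_cfg]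
  simp only [control, popSub, TM2.stepAux, contents_inr,
    Composite.update_contents_inr, triple_judge, update_triple_judge, Function.update_self]
  rw [readAnswer, ← List.map_tail, List.head?_map, List.head?_map] at ha
  subst ha
  exact h _ _

/-- The label counts the remaining tosses. A toss `true` ends the countdown and keeps the old pair,
so a fresh sample requires `j` tosses `false` and the flag `a`. The bound `1 ≤ m` leaves time for
writing. -/
theorem computes_coin (j : Fin (n + 1)) {μ : PMF (List (Option Bool))} {z : Bool × Bool}
    {r : Option (Option Bool)} {a : Bool} (hm : 1 ≤ m)
    (h : (machine MS MD s n).Computes m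
      (cfg MS MD s n (.inr ⟨.second, MS.main⟩) (r, z, a) [] y v₁ v₂ v₃ S₁ S₂ S₃) μ) :
    (machine MS MD s n).Computes (m + 1 + j)
      (cfg MS MD s n (.inl (.coin j)) (r, z, a) [] y v₁ v₂ v₃ S₁ S₂ S₃)
      ((dyadicCoin j).bind fun c => if c && a then μ else PMF.pure [some z.1, some z.2]) := by
  induction j using Fin.induction with
  | zero =>
    rw [Fin.val_zero, dyadicCoin, PMF.pure_bind, Bool.true_and]
    refine ProbTM.Computes.of_step fun b => ?_
    rw [stepWith_cfg]
    simp only [control, Fin.cases_zero, TM2.stepAux]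
    cases a
    · exact computes_write.mono hm
    · exact h
  | succ j ih =>
    rw [Fin.val_succ, dyadicCoin, PMF.bind_bind]
    refine ProbTM.Computes.of_coin fun b => ?_
    rw [stepWith_cfg]
    simp only [control, Fin.cases_succ, TM2.stepAux]
    cases b
    · exact ih
    · simp only [if_true, PMF.pure_bind, Bool.false_and]
      exact computes_write.mono (hm.trans ((Nat.le_succ m).trans (Nat.le_add_right _ _)))

variable (n) in
/-- A bound for the running time of `machine`, when `p` and `q` are bounds for the subroutines. -/
def timeBound (p q : Polynomial ℕ) : Polynomial ℕ :=
  2 * p + q.comp (Polynomial.X + 2) + 3 * Polynomial.X + Polynomial.C (n + 9)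

theorem computes_first {p : ℕ} {μ : PMF (List (Option Bool))} (hp : MS.Computes p (MS.init w) μ)
    {ν : Bool × Bool → PMF (List (Option Bool))}
    (h : ∀ v₁ S₁, (machine MS MD s n).Computes m
      (cfg MS MD s n (.inl (.ret .first)) f x y v₁ v₂ v₃ S₁ S₂ S₃)
        (ν (readBits ((S₁ MS.k₁).map MS.outputAlphabet)))) :
    (machine MS MD s n).Computes (p + m)
      (cfg MS MD s n (.inr ⟨.first, MS.main⟩) f x y MS.initialState v₂ v₃ (MS.init w).stk S₂ S₃)
      ((μ.map readBits).bind ν) := by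
  have := Composite.computes_running_of_computes (N := subs MS MD) (a := false)
    (start := (.reverse : Ctl n)) (flags := ((none, (false, false), false) : Flags)) (ret := .ret)
    (ctl := control MS MD s n) .first f (pair x y)
    (triple (X := fun i => (subs MS MD i).σ) MS.initialState v₂ v₃)
    (triple (X := fun i => ∀ k, List ((subs MS MD i).Γ k)) (MS.init w).stk S₂ S₃)
    hp readBits (m := m) ν fun c => by
      simp only [update_triple_first]
      exact h c.var c.stk
  simp only [Composite.running, update_triple_first] at this
  exact this

theorem computes_second {p : ℕ} {μ : PMF (List (Option Bool))} (hp : MS.Computes p (MS.init w) μ)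
    {ν : Bool × Bool → PMF (List (Option Bool))}
    (h : ∀ v₂ S₂, (machine MS MD s n).Computes m
      (cfg MS MD s n (.inl (.ret .second)) f x y v₁ v₂ v₃ S₁ S₂ S₃)
        (ν (readBits ((S₂ MS.k₁).map MS.outputAlphabet)))) :
    (machine MS MD s n).Computes (p + m)
      (cfg MS MD s n (.inr ⟨.second, MS.main⟩) f x y v₁ MS.initialState v₃ S₁ (MS.init w).stk S₃)
      ((μ.map readBits).bind ν) := by
  have := Composite.computes_running_of_computes (N := subs MS MD) (a := false)
    (start := (.reverse : Ctl n)) (flags := ((none, (false, false), false) : Flags)) (ret := .ret)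
    (ctl := control MS MD s n) .second f (pair x y)
    (triple (X := fun i => (subs MS MD i).σ) v₁ MS.initialState v₃)
    (triple (X := fun i => ∀ k, List ((subs MS MD i).Γ k)) S₁ (MS.init w).stk S₃)
    hp readBits (m := m) ν fun c => by
      simp only [update_triple_second]
      exact h c.var c.stk
  simp only [Composite.running, update_triple_second] at this
  exact this

theorem computes_judge {p : ℕ} {μ : PMF (List (Option Bool))} (hp : MD.Computes p (MD.init w) μ)
    {ν : Bool → PMF (List (Option Bool))}
    (h : ∀ v₃ S₃, (machine MS MD s n).Computes m
      (cfg MS MD s n (.inl (.ret .judge)) f x y v₁ v₂ v₃ S₁ S₂ S₃)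
        (ν (readAnswer ((S₃ MD.k₁).map MD.outputAlphabet)))) :
    (machine MS MD s n).Computes (p + m)
      (cfg MS MD s n (.inr ⟨.judge, MD.main⟩) f x y v₁ v₂ MD.initialState S₁ S₂ (MD.init w).stk)
      ((μ.map readAnswer).bind ν) := by
  have := Composite.computes_running_of_computes (N := subs MS MD) (a := false)
    (start := (.reverse : Ctl n)) (flags := ((none, (false, false), false) : Flags)) (ret := .ret)
    (ctl := control MS MD s n) .judge f (pair x y)
    (triple (X := fun i => (subs MS MD i).σ) v₁ v₂ MD.initialState)
    (triple (X := fun i => ∀ k, List ((subs MS MD i).Γ k)) S₁ S₂ (MD.init w).stk)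
    hp readAnswer (m := m) ν fun c => by
      simp only [update_triple_judge]
      exact h c.var c.stk
  simp only [Composite.running, update_triple_judge] at this
  exact this

/-- Empty stacks are written as the initial stacks for the empty word, which starts the invariant of
the loading loops. -/
theorem init_machine (w : List (Option Bool)) :
    (machine MS MD s n).init w = cfg MS MD s n (.inl .reverse) (none, (false, false), false) w []
      MS.initialState MS.initialState MD.initialState
      (MS.init []).stk (MS.init []).stk (MD.init []).stk := by
  have hv : (fun i => (subs MS MD i).initialState) =
      triple (X := fun i => (subs MS MD i).σ) MS.initialState MS.initialState MD.initialState := by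
    funext i; cases i <;> rfl
  have hS : ∀ M : ProbTM, (M.init []).stk = fun _ => [] := fun M => by
    simp only [ProbTM.init, List.map_nil]
    exact Function.update_eq_self _ _
  have hT : triple (X := fun i => ∀ k, List ((subs MS MD i).Γ k)) (fun _ => []) (fun _ => [])
      (fun _ => []) = fun _ _ => [] := by
    funext i; cases i <;> rfl
  have hk : Function.update (Composite.contents (subs MS MD) (pair [] []) fun _ _ => []) (.inl false)
      w = Composite.contents (subs MS MD) (pair w []) fun _ _ => [] := by
    rw [Composite.update_contents_inl, update_pair_false]
  have hk' : Composite.contents (subs MS MD) (pair [] []) (fun _ _ => []) = fun _ => [] := by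
    funext k
    rcases k with (_ | _) | k <;> rfl
  rw [hk'] at hk
  rw [cfg, hS, hS, hT, ← hk, ← hv]
  have hw : w.map (machine MS MD s n).inputAlphabet.symm = w := List.map_id w
  rw [ProbTM.init, hw]
  rfl

/-- Two symbols suffice: the first must be `1` and the second must be absent. -/
theorem readAnswer_map_some (o : List Bool) : readAnswer (o.map some) = decide (o = [true]) := by
  rcases o with _ | ⟨a, _ | ⟨b, o⟩⟩ <;> simp [readAnswer]

theorem computes_machine {Sim : ℕ → List Bool → PMF (Bool × Bool)}
    {D : ℕ → Bool × Bool × List Bool → PMF (List Bool)} {p q : Polynomial ℕ}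
    (hS : ∀ κ t, MS.Computes (p.eval (unaryPair κ t).length) (MS.init (unaryPair κ t))
      ((Sim κ t).map fun b => (encodeBits b).map some))
    (hD : ∀ κ z, MD.Computes (q.eval (unaryPair κ (encodeTriple z)).length)
      (MD.init (unaryPair κ (encodeTriple z))) ((D κ z).map fun b => b.map some))
    (κ : ℕ) (t : List Bool) :
    (machine MS MD s n).Computes ((timeBound n p q).eval (unaryPair κ t).length)
      ((machine MS MD s n).init (unaryPair κ t))
      ((resample Sim D s n κ t).map fun b => (encodeBits b).map some) := by
  set P := p.eval (unaryPair κ t).length with hP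
  set Q := q.eval ((unaryPair κ t).length + 2) with hQ
  have hlen : (unaryPair κ t).length = κ + 1 + t.length := by simp [unaryPair]; omega
  -- The time is that of the phases, nested from the last to the first. The loops contribute `κ` for
  -- loading the distinguisher, `κ` and the length of `t` for distributing the input, and the full
  -- input length for reversing it.
  have key : (machine MS MD s n).Computes
      (P + (Q + (P + 2 + 1 + n + 1) + 1 + κ + 1) + 1 + κ + 1 + t.length + 1 +
        (unaryPair κ t).length)
      ((machine MS MD s n).init (unaryPair κ t))
      ((((Sim κ t).map fun b => (encodeBits b).map some).map readBits).bind fun z =>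
        (((D κ (z.1, z.2, t)).map fun b => b.map some).map readAnswer).bind fun a =>
          (dyadicCoin n).bind fun c => if c && (a == s) then
            (((Sim κ t).map fun b => (encodeBits b).map some).map readBits).bind
              fun z' => PMF.pure [some z'.1, some z'.2]
            else PMF.pure [some z.1, some z.2]) := by
    rw [init_machine]
    refine computes_reverse fun r => ?_
    have hrev : (unaryPair κ t).reverse ++ [] =
        t.reverse.map some ++ none :: List.replicate κ (some true) := by
      simp [unaryPair]
    rw [hrev, ← List.length_reverse (as := t)]
    refine computes_spread fun r => ?_
    simp only [List.reverse_reverse, List.append_nil]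
    refine computes_unary fun r => ?_
    refine computes_first (hS κ t) fun v₁ S₁ => ?_
    refine computes_ret_first rfl fun S₁ => ?_
    rw [List.append_nil]
    refine computes_load fun r => ?_
    generalize readBits _ = z
    -- The two extra bits in the distinguisher's input account for the composition with `X + 2` in
    -- `timeBound`.
    have hlen' : (unaryPair κ (encodeTriple (z.1, z.2, t))).length =
        (unaryPair κ t).length + 2 := by
      simp [unaryPair, encodeTriple]; omega
    have hD' := hD κ (z.1, z.2, t)
    rw [hlen', ← hQ] at hD'
    refine computes_judge hD' fun v₃ S₃ => ?_
    refine computes_ret_judge rfl fun r S₃ => ?_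
    refine computes_coin (Fin.last n) (by omega) ?_
    exact computes_second (hS κ t) fun v₂ S₂ => computes_ret_second rfl
  have hbits : ((Sim κ t).map fun b => (encodeBits b).map some).map readBits = Sim κ t := by
    rw [PMF.map_comp]
    exact PMF.map_id _
  have hanswer : ∀ z : Bool × Bool,
      ((D κ (z.1, z.2, t)).map fun b => b.map some).map readAnswer = accepts D κ (z.1, z.2, t) := by
    intro z
    rw [PMF.map_comp, accepts]
    exact congrArg (fun g => PMF.map g _) (funext readAnswer_map_some)
  simp only [hbits, hanswer] at key
  have heq : ((resample Sim D s n κ t).map fun b => (encodeBits b).map some) =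
      (Sim κ t).bind fun z => (accepts D κ (z.1, z.2, t)).bind fun a =>
        (dyadicCoin n).bind fun c => if c && (a == s) then
          (Sim κ t).bind fun z' => PMF.pure [some z'.1, some z'.2]
          else PMF.pure [some z.1, some z.2] := by
    simp only [resample, PMF.map_bind, apply_ite (PMF.map _), PMF.pure_map]
    rfl
  rw [heq]
  refine key.mono ?_
  simp only [timeBound, Polynomial.eval_add, Polynomial.eval_mul, Polynomial.eval_comp,
    Polynomial.eval_X, Polynomial.eval_ofNat, Polynomial.eval_C, ← hP, ← hQ]
  omega

end Resample

/-- The number `n` is built into the control labels of the machine, so it has to be independent of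
`κ`. -/
theorem IsSimulator.resample {Sim : ℕ → List Bool → PMF (Bool × Bool)} (hS : IsSimulator Sim)
    {D : ℕ → Bool × Bool × List Bool → PMF (List Bool)} (hD : IsPPT encodeTriple id D) (s : Bool)
    (n : ℕ) : IsSimulator (resample Sim D s n) := by
  obtain ⟨MS, p, hp⟩ := hS.exists_computes
  obtain ⟨MD, q, hq⟩ := hD.exists_computes
  exact isPPT_of_computes _ _ (Resample.computes_machine hp hq)

/-! ### The uniform simulator -/

/-- The simulator that outputs two independent fair bits. -/
def uniformSim (_ : ℕ) (_ : List Bool) : PMF (Bool × Bool) :=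
  (PMF.uniformOfFintype Bool).bind fun b => (PMF.uniformOfFintype Bool).bind fun b' =>
    PMF.pure (b', b)

/-- Push the bit `c`, and then halt or go on. -/
def uniformProgram (c : Bool) : Bool → TM2.Stmt (fun _ : Bool => Option Bool) Bool Unit
  | true => .push true (fun _ => some c) (.goto fun _ => false)
  | false => .push true (fun _ => some c) .halt

/-- A machine that outputs two coins. -/
def uniformMachine : ProbTM where
  K := Bool
  k₀ := false
  k₁ := true
  Γ _ := Option Bool
  Λ := Bool
  main := true
  σ := Unit
  initialState := ()
  Γk₀Fin := inferInstanceAs (Fintype (Option Bool))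
  m := uniformProgram false
  m' := uniformProgram true
  inputAlphabet := Equiv.refl _
  outputAlphabet := Equiv.refl _

theorem isSimulator_uniformSim : IsSimulator uniformSim := by
  refine isPPT_of_computes uniformMachine 2 fun κ t => ?_
  simp only [uniformSim, PMF.map_bind, PMF.pure_map, Polynomial.eval_ofNat]
  refine ProbTM.Computes.of_coin fun b => ?_
  refine ProbTM.Computes.of_coin fun b' => ?_
  cases b <;> cases b' <;> exact ProbTM.Computes.of_halted rfl 0

/-! ### Expectations -/

theorem toReal_bind_apply {α β : Type*} (p : PMF α) (f : α → PMF β) (b : β) :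
    (p.bind f b).toReal = ∑' a, (p a).toReal * (f a b).toReal := by
  rw [PMF.bind_apply, ENNReal.tsum_toReal_eq
    fun a => ENNReal.mul_ne_top (p.apply_ne_top a) ((f a).apply_ne_top b)]
  simp only [ENNReal.toReal_mul]

theorem toReal_apply_le_one {α : Type*} (p : PMF α) (a : α) : (p a).toReal ≤ 1 :=
  ENNReal.toReal_le_of_le_ofReal zero_le_one (by simpa using p.coe_le_one a)

theorem summable_toReal {α : Type*} (p : PMF α) : Summable fun a => (p a).toReal :=
  ENNReal.summable_toReal p.tsum_coe_ne_top

theorem tsum_toReal {α : Type*} (p : PMF α) : ∑' a, (p a).toReal = 1 := by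
  rw [← ENNReal.tsum_toReal_eq p.apply_ne_top, p.tsum_coe, ENNReal.toReal_one]

theorem sum_toReal {α : Type*} [Fintype α] (p : PMF α) : ∑ a, (p a).toReal = 1 := by
  rw [← tsum_fintype (L := .unconditional _), tsum_toReal]

/-- The expectation of `g` under `p`. -/
def mean {α : Type*} (p : PMF α) (g : α → ℝ) : ℝ := ∑' a, (p a).toReal * g a

/-- Transcripts range over an infinite set, and a divergent `tsum` would be `0` by default.
Boundedness of the integrand excludes this. -/
theorem summable_mean {α : Type*} (p : PMF α) {g : α → ℝ} {C : ℝ} (hg : ∀ a, |g a| ≤ C) :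
    Summable fun a => (p a).toReal * g a := by
  refine Summable.of_norm_bounded ((summable_toReal p).mul_right C) fun a => ?_
  rw [norm_mul, Real.norm_of_nonneg ENNReal.toReal_nonneg]
  exact mul_le_mul_of_nonneg_left (hg a) ENNReal.toReal_nonneg

theorem mean_const {α : Type*} (p : PMF α) (c : ℝ) : mean p (fun _ => c) = c := by
  rw [mean, tsum_mul_right, tsum_toReal, one_mul]

theorem mean_mul_left {α : Type*} (p : PMF α) (c : ℝ) (g : α → ℝ) :
    mean p (fun a => c * g a) = c * mean p g := by
  simp only [mean, mul_left_comm _ c, tsum_mul_left]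

theorem mean_add {α : Type*} (p : PMF α) {g h : α → ℝ} {C C' : ℝ} (hg : ∀ a, |g a| ≤ C)
    (hh : ∀ a, |h a| ≤ C') : mean p (fun a => g a + h a) = mean p g + mean p h := by
  simp only [mean, mul_add]
  exact (summable_mean p hg).tsum_add (summable_mean p hh)

theorem mean_sub {α : Type*} (p : PMF α) {g h : α → ℝ} {C C' : ℝ} (hg : ∀ a, |g a| ≤ C)
    (hh : ∀ a, |h a| ≤ C') : mean p (fun a => g a - h a) = mean p g - mean p h := by
  simp only [mean, mul_sub]
  exact (summable_mean p hg).tsum_sub (summable_mean p hh)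

theorem mean_mono {α : Type*} (p : PMF α) {g h : α → ℝ} {C C' : ℝ} (hg : ∀ a, |g a| ≤ C)
    (hh : ∀ a, |h a| ≤ C') (hgh : ∀ a, g a ≤ h a) : mean p g ≤ mean p h :=
  (summable_mean p hg).tsum_le_tsum
    (fun a => mul_le_mul_of_nonneg_left (hgh a) ENNReal.toReal_nonneg) (summable_mean p hh)

theorem toReal_bind_apply_eq_mean {α β : Type*} (p : PMF α) (f : α → PMF β) (b : β) :
    (p.bind f b).toReal = mean p fun a => (f a b).toReal := toReal_bind_apply p f b

/-! ### The distribution of the updated simulator -/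

theorem toReal_dyadicCoin (n : ℕ) : (dyadicCoin n true).toReal = (1 / 2) ^ n := by
  induction n with
  | zero => simp [dyadicCoin]
  | succ n ih =>
    rw [dyadicCoin, toReal_bind_apply, tsum_fintype, Fintype.sum_bool]
    simp [ih, pow_succ']

theorem toReal_apply_not (p : PMF Bool) (b : Bool) : (p !b).toReal = 1 - (p b).toReal := by
  have := sum_toReal p
  rw [Fintype.sum_bool] at this
  cases b <;> simp only [Bool.not_true, Bool.not_false] <;> linarith

theorem toReal_accepts_true (D : ℕ → Bool × Bool × List Bool → PMF (List Bool)) (κ : ℕ)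
    (z : Bool × Bool × List Bool) : (accepts D κ z true).toReal = (D κ z [true]).toReal := by
  rw [accepts, PMF.map_apply, tsum_eq_single [true]]
  · simp
  · intro o ho
    simp [ho]

/-- The probability that `D` answers `s` on a simulated pair and the transcript `t`. -/
def meanAnswer (Sim : ℕ → List Bool → PMF (Bool × Bool))
    (D : ℕ → Bool × Bool × List Bool → PMF (List Bool)) (s : Bool) (κ : ℕ) (t : List Bool) : ℝ :=
  ∑ b, (Sim κ t b).toReal * (accepts D κ (b.1, b.2, t) s).toReal

variable {Sim : ℕ → List Bool → PMF (Bool × Bool)}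
  {D : ℕ → Bool × Bool × List Bool → PMF (List Bool)}

/-- With `ε = (1/2)^n`, the pair `z` loses the mass `ε * Sim(z) * Pr[D answers s on z]`. The total
mass released for `t` is `ε * meanAnswer`, and it is redistributed in proportion to `Sim`. The
change is therefore a factor, whose logarithm is added to the potential. -/
theorem toReal_resample (s : Bool) (n κ : ℕ) (t : List Bool) (z : Bool × Bool) :
    (resample Sim D s n κ t z).toReal = (Sim κ t z).toReal *
      (1 + (1 / 2) ^ n * (meanAnswer Sim D s κ t - (accepts D κ (z.1, z.2, t) s).toReal)) := by
  have hcoin : ∀ (a : Bool) (b : Bool × Bool),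
      ((dyadicCoin n).bind (fun c => if c && (a == s) then Sim κ t else PMF.pure b) z).toReal =
        (PMF.pure b z).toReal + if a = s then
          (1 / 2) ^ n * ((Sim κ t z).toReal - (PMF.pure b z).toReal) else 0 := by
    intro a b
    have h := toReal_apply_not (dyadicCoin n) true
    rw [toReal_dyadicCoin] at h
    rw [toReal_bind_apply, tsum_fintype, Fintype.sum_bool, toReal_dyadicCoin]
    by_cases ha : a = s
    · simp only [ha, Bool.true_and, Bool.false_and, beq_self_eq_true, if_true, Bool.false_eq_true,
        if_false]
      rw [← Bool.not_true, h]
      ring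
    · simp only [ha, Bool.true_and, Bool.false_and, beq_iff_eq, Bool.false_eq_true, if_false]
      rw [← Bool.not_true, h]
      ring
  have hans : ∀ b : Bool × Bool, ((accepts D κ (b.1, b.2, t)).bind (fun a => (dyadicCoin n).bind
      (fun c => if c && (a == s) then Sim κ t else PMF.pure b)) z).toReal =
        (PMF.pure b z).toReal + (accepts D κ (b.1, b.2, t) s).toReal *
          ((1 / 2) ^ n * ((Sim κ t z).toReal - (PMF.pure b z).toReal)) := by
    intro b
    rw [toReal_bind_apply, tsum_fintype]
    simp only [hcoin, mul_add, Finset.sum_add_distrib, ← Finset.sum_mul, sum_toReal, one_mul,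
      mul_ite, mul_zero, Finset.sum_ite_eq', Finset.mem_univ, if_true]
  have hpure : ∀ b : Bool × Bool, (PMF.pure b z).toReal = if z = b then 1 else 0 := by
    intro b
    rw [PMF.pure_apply]
    split <;> simp
  rw [resample, toReal_bind_apply, tsum_fintype]
  simp only [hans, hpure, mul_add, Finset.sum_add_distrib, mul_sub, Finset.sum_sub_distrib,
    mul_ite, mul_zero, mul_one, Finset.sum_ite_eq, Finset.mem_univ, if_true, meanAnswer]
  simp only [← mul_assoc, ← Finset.sum_mul]
  ring

theorem abs_toReal_le_one {α : Type*} (p : PMF α) (a : α) : |(p a).toReal| ≤ 1 := by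
  rw [abs_of_nonneg ENNReal.toReal_nonneg]
  exact toReal_apply_le_one p a

theorem meanAnswer_nonneg (s : Bool) (κ : ℕ) (t : List Bool) : 0 ≤ meanAnswer Sim D s κ t :=
  Finset.sum_nonneg fun _ _ => mul_nonneg ENNReal.toReal_nonneg ENNReal.toReal_nonneg

theorem meanAnswer_le_one (s : Bool) (κ : ℕ) (t : List Bool) : meanAnswer Sim D s κ t ≤ 1 := by
  rw [← sum_toReal (Sim κ t)]
  exact Finset.sum_le_sum fun b _ =>
    mul_le_of_le_one_right ENNReal.toReal_nonneg (toReal_apply_le_one _ _)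

theorem meanAnswer_not (s : Bool) (κ : ℕ) (t : List Bool) :
    meanAnswer Sim D (!s) κ t = 1 - meanAnswer Sim D s κ t := by
  simp only [meanAnswer, toReal_apply_not, mul_sub, mul_one, Finset.sum_sub_distrib, sum_toReal]

/-- By how much `D` answers `s` more often on a simulated pair than on the given one. -/
def answerGap (Sim : ℕ → List Bool → PMF (Bool × Bool))
    (D : ℕ → Bool × Bool × List Bool → PMF (List Bool)) (s : Bool) (κ : ℕ)
    (w : Bool × Bool × List Bool) : ℝ :=
  meanAnswer Sim D s κ w.2.2 - (accepts D κ w s).toReal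

theorem abs_answerGap_le (s : Bool) (κ : ℕ) (w : Bool × Bool × List Bool) :
    |answerGap Sim D s κ w| ≤ 1 := by
  have h₁ := meanAnswer_nonneg (Sim := Sim) (D := D) s κ w.2.2
  have h₂ := meanAnswer_le_one (Sim := Sim) (D := D) s κ w.2.2
  have h₃ := toReal_apply_le_one (accepts D κ w) s
  have h₄ : 0 ≤ (accepts D κ w s).toReal := ENNReal.toReal_nonneg
  rw [answerGap, abs_le]
  constructor <;> linarith

theorem answerGap_not (s : Bool) (κ : ℕ) (w : Bool × Bool × List Bool) :
    answerGap Sim D (!s) κ w = -answerGap Sim D s κ w := by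
  rw [answerGap, answerGap, meanAnswer_not, toReal_apply_not]
  ring

/-- The simulated pair depends on the real execution only through the transcript, so both acceptance
probabilities are means over the same real distribution. This identifies the advantage with the
first-order gain of the potential. -/
theorem acceptProb_simulated_sub_real (π : Protocol) (κ : ℕ) :
    acceptProb D κ (π.simulated Sim κ) - acceptProb D κ (π.real κ) =
      mean (π.real κ) (answerGap Sim D true κ) := by
  have h : acceptProb D κ (π.simulated Sim κ) =
      mean (π.real κ) fun w => meanAnswer Sim D true κ w.2.2 := by
    rw [acceptProb, Protocol.simulated, PMF.bind_bind, toReal_bind_apply_eq_mean]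
    congr 1
    funext w
    rw [PMF.bind_map, toReal_bind_apply, tsum_fintype, meanAnswer]
    simp only [toReal_accepts_true, Function.comp_apply]
  rw [h, acceptProb, toReal_bind_apply_eq_mean, ← mean_sub (C := 1) (C' := 1)]
  · exact congrArg _ (funext fun w => by rw [answerGap, toReal_accepts_true])
  · intro w
    rw [abs_of_nonneg (meanAnswer_nonneg _ _ _)]
    exact meanAnswer_le_one _ _ _
  · exact fun w => abs_toReal_le_one _ _

/-! ### The potential -/

/-- The potential of a simulator: the expected logarithm of the probability that it gives to the
actual outputs. -/
def potential (π : Protocol) (Sim : ℕ → List Bool → PMF (Bool × Bool)) (κ : ℕ) : ℝ :=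
  mean (π.real κ) fun w => Real.log (Sim κ w.2.2 (w.1, w.2.1)).toReal

/-- From `log y ≥ 1 - 1/y` at `y = 1 + x`, the remaining difference is `x² (1 + 2x) / (1 + x)`,
which is nonnegative exactly because `x ≥ -1/2`. -/
theorem le_log_one_add {x : ℝ} (hx : -(1 / 2) ≤ x) : x - 2 * x ^ 2 ≤ Real.log (1 + x) := by
  have h : 0 < 1 + x := by linarith
  refine le_trans ?_ (Real.one_sub_inv_le_log_of_pos h)
  rw [← sub_nonneg]
  have : 1 - (1 + x)⁻¹ - (x - 2 * x ^ 2) = x ^ 2 * (1 + 2 * x) / (1 + x) := by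
    field_simp
    ring
  rw [this]
  exact div_nonneg (mul_nonneg (sq_nonneg x) (by linarith)) h.le

theorem abs_log_toReal_le {α : Type*} {p : PMF α} {a : α} {c : ℝ} (hc : 0 < c)
    (h : c ≤ (p a).toReal) : |Real.log (p a).toReal| ≤ -Real.log c := by
  rw [abs_of_nonpos (Real.log_nonpos ENNReal.toReal_nonneg (toReal_apply_le_one p a))]
  exact neg_le_neg (Real.log_le_log hc h)

/-- All terms are nonpositive; no summability is needed. -/
theorem potential_nonpos (π : Protocol) (κ : ℕ) : potential π Sim κ ≤ 0 :=
  tsum_nonpos fun _ => mul_nonpos_of_nonneg_of_nonpos ENNReal.toReal_nonneg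
    (Real.log_nonpos ENNReal.toReal_nonneg (toReal_apply_le_one _ _))

/-- Since `n ≥ 1` and the gap is at most `1` in absolute value, the factor is at least `1/2`. A
positive lower bound on all masses thus survives each round and keeps the logarithms bounded. -/
theorem half_mul_le_toReal_resample {c : ℝ} {κ : ℕ} {t : List Bool} {z : Bool × Bool} {n : ℕ}
    (hn : 1 ≤ n) (s : Bool) (h : c ≤ (Sim κ t z).toReal) :
    1 / 2 * c ≤ (resample Sim D s n κ t z).toReal := by
  have hg := abs_le.1 (abs_answerGap_le (Sim := Sim) (D := D) s κ (z.1, z.2, t))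
  have hn : ((1 : ℝ) / 2) ^ n ≤ 1 / 2 := pow_le_of_le_one (by norm_num) (by norm_num) (by omega)
  have hn' : (0 : ℝ) ≤ (1 / 2) ^ n := by positivity
  have hf : 0 ≤ (Sim κ t z).toReal := ENNReal.toReal_nonneg
  rw [toReal_resample]
  rw [answerGap] at hg
  have : 1 / 2 ≤ 1 + (1 / 2) ^ n *
      (meanAnswer Sim D s κ t - (accepts D κ (z.1, z.2, t) s).toReal) := by
    nlinarith
  nlinarith

/-- Pointwise the logarithm increases by `log (1 + x)` with `x = ε * gap` and `|x| ≤ ε ≤ 1/2`. The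
linear term averages to the signed advantage, and the quadratic loss is at most `2ε²`. -/
theorem potential_resample {c : ℝ} (hc : 0 < c) (π : Protocol) {κ n : ℕ} (hn : 1 ≤ n) (s : Bool)
    (h : ∀ t z, c ≤ (Sim κ t z).toReal) :
    potential π Sim κ + ((1 / 2) ^ n * mean (π.real κ) (answerGap Sim D s κ) -
      2 * ((1 / 2) ^ n) ^ 2) ≤ potential π (resample Sim D s n) κ := by
  have hlog := fun w : Bool × Bool × List Bool => abs_log_toReal_le hc (h w.2.2 (w.1, w.2.1))
  have hlog' := fun w : Bool × Bool × List Bool => abs_log_toReal_le (half_pos hc)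
    ((by ring : c / 2 = 1 / 2 * c).trans_le
      (half_mul_le_toReal_resample (D := D) hn s (h w.2.2 (w.1, w.2.1))))
  set ε : ℝ := (1 / 2) ^ n with hε
  have hε₀ : 0 ≤ ε := by positivity
  have hε₁ : ε ≤ 1 / 2 := pow_le_of_le_one (by norm_num) (by norm_num) (by omega)
  have hgap : ∀ w, |ε * answerGap Sim D s κ w| ≤ ε := by
    intro w
    rw [abs_mul, abs_of_nonneg hε₀]
    exact mul_le_of_le_one_right hε₀ (abs_answerGap_le s κ w)
  have hconst : ∀ _ : Bool × Bool × List Bool, |2 * ε ^ 2| ≤ 2 * ε ^ 2 :=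
    fun _ => (abs_of_nonneg (by positivity)).le
  have hdiff : ∀ w, |ε * answerGap Sim D s κ w - 2 * ε ^ 2| ≤ ε + 2 * ε ^ 2 :=
    fun w => (abs_sub _ _).trans (add_le_add (hgap w) (hconst w))
  have hsum : potential π Sim κ + (ε * mean (π.real κ) (answerGap Sim D s κ) - 2 * ε ^ 2) =
      mean (π.real κ) fun w => Real.log (Sim κ w.2.2 (w.1, w.2.1)).toReal +
        (ε * answerGap Sim D s κ w - 2 * ε ^ 2) := by
    rw [mean_add _ hlog hdiff, mean_sub _ hgap hconst, mean_const, mean_mul_left, potential]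
  rw [hsum, potential]
  refine mean_mono _ (fun w => (abs_add_le _ _).trans (add_le_add (hlog w) (hdiff w))) hlog'
    fun w => ?_
  have hw := abs_le.1 (hgap w)
  rw [toReal_resample, ← hε, Real.log_mul (hc.trans_le (h _ _)).ne', ← answerGap.eq_1]
  · have := le_log_one_add (x := ε * answerGap Sim D s κ w) (by linarith)
    have hsq : (ε * answerGap Sim D s κ w) ^ 2 ≤ ε ^ 2 := sq_le_sq.2 (by
      rw [abs_of_nonneg hε₀]; exact hgap w)
    linarith
  · rw [answerGap] at hw
    linarith

end

end TwoParty

/-! ### The increment argument -/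

theorem theorem3p1 (π : TwoParty.Protocol) (ρ : ℝ) (hρ : 0 < ρ) (I : Set ℕ) (hI : I.Infinite) :
    ∃ Sim : ℕ → List Bool → PMF (Bool × Bool), TwoParty.IsSimulator Sim ∧
      ∃ I' : Set ℕ, I' ⊆ I ∧ I'.Infinite ∧
        TwoParty.IndistinguishableIn TwoParty.encodeTriple (fun _ => ρ) I'
          π.real (π.simulated Sim) := by
  open TwoParty in
  by_contra hcon
  -- The bound `ε ≤ ρ/4` makes the loss `2ε²` at most half of the gain `ερ`; `1 ≤ n` ensures `ε ≤
  -- 1/2`.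
  obtain ⟨n, hn₁, hn⟩ : ∃ n : ℕ, 1 ≤ n ∧ ((1 : ℝ) / 2) ^ n ≤ ρ / 4 := by
    obtain ⟨n, hn⟩ := exists_pow_lt_of_lt_one (by positivity : 0 < ρ / 4)
      (by norm_num : (1 : ℝ) / 2 < 1)
    exact ⟨n + 1, by omega, (pow_le_pow_of_le_one (by norm_num) (by norm_num) n.le_succ).trans hn.le⟩
  set ε : ℝ := (1 / 2) ^ n with hε
  have hε₀ : 0 < ε := by positivity
  -- After `j` rounds the potential has risen by `j * (ε * ρ / 2)`, but only on an infinite set `J`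
  -- that may shrink in each round. The constant `c` depends on `j` and not on `κ`.
  have key : ∀ j : ℕ, ∃ (Sim : ℕ → List Bool → PMF (Bool × Bool)) (c : ℝ) (J : Set ℕ),
      IsSimulator Sim ∧ 0 < c ∧ (∀ κ t z, c ≤ (Sim κ t z).toReal) ∧ J ⊆ I ∧ J.Infinite ∧
        ∀ κ ∈ J, Real.log (1 / 4) + j * (ε * ρ / 2) ≤ potential π Sim κ := by
    intro j
    induction j with
    | zero =>
      have h : ∀ κ t z, (uniformSim κ t z).toReal = 1 / 4 := by
        intro κ t z
        simp only [uniformSim, toReal_bind_apply, tsum_fintype]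
        obtain ⟨_ | _, _ | _⟩ := z <;> simp [PMF.pure_apply] <;> norm_num
      refine ⟨uniformSim, 1 / 4, I, isSimulator_uniformSim, by norm_num, fun κ t z => (h κ t z).ge,
        subset_rfl, hI, fun κ _ => ?_⟩
      simp only [potential, h, mean_const, Nat.cast_zero, zero_mul, add_zero, le_refl]
    | succ j ih =>
      obtain ⟨Sim, c, J, hSim, hc, hcS, hJI, hJ, hpot⟩ := ih
      have hbad : ¬ IndistinguishableIn encodeTriple (fun _ => ρ) J π.real (π.simulated Sim) :=
        fun h => hcon ⟨Sim, hSim, J, hJI, hJ, h⟩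
      simp only [IndistinguishableIn, not_forall] at hbad
      obtain ⟨D, hD, hbad⟩ := hbad
      push Not at hbad
      -- The advantage exceeds `ρ` in absolute value for unboundedly many `κ` in `J`, so one of its
      -- two signs occurs infinitely often. Otherwise both exceptional sets lie below some `B`, and
      -- failure beyond `B + 1` is contradictory.
      have hex : ∃ s : Bool, {κ ∈ J | ρ < mean (π.real κ) (answerGap Sim D s κ)}.Infinite := by
        by_contra hfin
        push Not at hfin
        obtain ⟨B, hB⟩ := ((hfin true).union (hfin false)).bddAbove
        obtain ⟨κ, hκJ, hκ, hlt⟩ := hbad (B + 1)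
        rw [abs_sub_comm, acceptProb_simulated_sub_real, lt_abs] at hlt
        have hneg : answerGap Sim D false κ = fun w => -1 * answerGap Sim D true κ w :=
          funext fun w => (answerGap_not true κ w).trans (by ring)
        have hκB : κ ≤ B := hB <| hlt.imp (fun h => ⟨hκJ, h⟩) fun h => ⟨hκJ, by
          rw [hneg, mean_mul_left]
          linarith⟩
        omega
      obtain ⟨s, hs⟩ := hex
      refine ⟨resample Sim D s n, 1 / 2 * c, _, hSim.resample hD s n, by positivity,
        fun κ t z => half_mul_le_toReal_resample hn₁ s (hcS κ t z), fun κ hκ => hJI hκ.1, hs,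
        fun κ hκ => ?_⟩
      refine le_trans ?_ (potential_resample hc π hn₁ s (hcS κ))
      have h₁ := hpot κ hκ.1
      have h₂ := hκ.2
      rw [← hε]
      push_cast
      nlinarith
  -- Enough rounds to lift the potential from `log (1/4)` above `0`. A single `κ` in the final set
  -- gives the contradiction.
  obtain ⟨j, hj⟩ := exists_nat_gt (-Real.log (1 / 4) / (ε * ρ / 2))
  obtain ⟨Sim, c, J, -, -, -, -, hJ, hpot⟩ := key j
  obtain ⟨κ, hκ⟩ := hJ.nonempty
  have := hpot κ hκ
  rw [div_lt_iff₀ (by positivity)] at hj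
  linarith [potential_nonpos (Sim := Sim) π κ]
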